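/- **Setting.** Let $(\Omega,\mathcal A,\mathbb P)$ be a probability space and $X=(X_i)_{i\ge1}$ a stationary process on it with values in a measurable space $E$. Let $T(x_1,x_2,\dots)=(x_2,x_3,\dots)$ be the shift on $E^{\mathbb N_+}$. Let $\mathcal Y$ be a real normed vector space with its Borel $\sigma$-field, and for each $n\ge1$ let $S_n\Phi:E^{\mathbb N_+}\to\mathcal Y$ be measurable. Let $\mu_n$ be the law of $S_n\Phi(X)/n$. Let $(k(n))_{n\ge1}$ be a non-decreasing sequence of positive integers and put $$\mu_n^\omega=\frac1{k(n)}\sum_{j=1}^{k(n)}\delta_{x_{n,j}(\omega)},\qquad x_{n,j}(\omega)=\frac{S_n\Phi(T^{(j-1)n}X(\omega))}{n}.$$ $B(x,\epsilon)$ denotes the closed ball of center $x$ and radius $\epsilon$, and $\log 0=-\infty$. For sub-$\sigma$-algebras $\mathcal U,\mathcal V$ of $\mathcal A$ let $\alpha(\mathcal U,\mathcal V)=\sup\{|\mathbb P(U)\mathbb P(V)-\mathbb P(U\cap V)|:U\in\mathcal U,V\in\mathcal V\}$. Put $\alpha_{X,0}=1/2$, $\alpha_{X,m}=\sup_{i\ge1}\alpha(\sigma(X_k:k\le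 i),\sigma(X_j:j\ge i+m))$ for $m\ge1$, and $\alpha_X^{-1}(u)=\inf\{m\ge 0:\alpha_{X,m}\le u\}$ for $u\in[0,1]$ (with $\inf\emptyset=\infty$). A sequence $(\nu_n)_{n\ge1}$ of probability measures on $\mathcal Y$ satisfies the LDP with rate function $I$ if $I:\mathcal Y\to[0,\infty]$ is lower semicontinuous and for every Borel set $\Gamma$, with interior $\Gamma^\circ$ and closure $\overline\Gamma$, $$-\inf_{\Gamma^\circ}I\le\liminf_{n\to\infty}\tfrac1n\log\nu_n(\Gamma)\le\limsup_{n\to\infty}\tfrac1n\log\nu_n(\Gamma)\le-\inf_{\overline\Gamma}I.$$ It is exponentially tight if for every real $a$ there is a compact $K\subset\mathcal Y$ with $\limsup_{n\to\infty}\frac1n\log\nu_n(\mathcal Y\setminus K)\le-a$. **Theorem 2.1.** Assume * (A1) $(\mu_n)_{n\ge1}$ satisfies the LDP with rate function $I$; * (A2) $\int_0^1(\alpha_X^{-1}(u))^h\,du<\infty$ for all real $h>0$; * (A3) there are functions $S_n\Phi_n:E^{\mathbb N_+}\to\mathcal Y$ ($n\ge1$), each depending only on the first $2n$ coordinates, such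 that $\sup_{z\in E^{\mathbb N_+}}\|S_n\Phi(z)-S_n\Phi_n(z)\|/n\to0$ as $n\to\infty$. Then: 1. Let $x\in\mathcal Y$ with $I(x)<\infty$. If $\liminf_{n\to\infty}\frac{\log k(n)}n>I(x)$ then, with probability 1, $$\lim_{\epsilon\to0^+}\liminf_{n\to\infty}\tfrac1n\log\mu_n^\omega(B(x,\epsilon))=\lim_{\epsilon\to0^+}\limsup_{n\to\infty}\tfrac1n\log\mu_n^\omega(B(x,\epsilon))=-I(x).$$ If $\limsup_{n\to\infty}\frac{\log k(n)}n<I(x)$ then there exists $\epsilon>0$ such that, with probability 1, for all $n$ large enough the set $\{1\le j\le k(n):S_n\Phi(T^{(j-1)n}X(\omega))/n\in B(x,\epsilon)\}$ is empty. 2. Let $x\in\mathcal Y$ with $I(x)=\infty$. With probability 1, $$\lim_{\epsilon\to0^+}\limsup_{n\to\infty}\tfrac1n\log\mu_n^\omega(B(x,\epsilon))=-I(x)=-\infty.$$ 3. If $(\mu_n)_{n\ge1}$ is exponentially tight, then, with probability 1, $(\mu_n^\omega)_{n\ge1}$ is exponentially tight. -/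

import Mathlib

open Filter Topology MeasureTheory
open scoped ENNReal

noncomputable section

namespace LocalFluctuations

/-- The coefficient `α(𝒰, 𝒱) = sup { |P(U) P(V) - P(U ∩ V)| : U ∈ 𝒰, V ∈ 𝒱 }`. -/
def alphaCoeff {Ω : Type*} [MeasurableSpace Ω] (P : Measure Ω) (𝒰 𝒱 : MeasurableSpace Ω) : ℝ :=
  sSup {r : ℝ | ∃ U V : Set Ω, MeasurableSet[𝒰] U ∧ MeasurableSet[𝒱] V ∧
    r = |P.real U * P.real V - P.real (U ∩ V)|}

/-- The Rosenblatt coefficients of a process: `α_{X,0} = 1/2` and, for `m ≥ 1`,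
`α_{X,m} = sup_i α(σ(X_k : k ≤ i), σ(X_j : j ≥ i + m))`.
The time index starts at `0`: `X i` is the variable usually written `X_{i+1}`. -/
def rosenblatt {Ω E : Type*} [MeasurableSpace Ω] [MeasurableSpace E] (P : Measure Ω)
    (X : ℕ → Ω → E) (m : ℕ) : ℝ :=
  if m = 0 then 1 / 2
  else ⨆ i : ℕ, alphaCoeff P
    (⨆ k ∈ Set.Iic i, MeasurableSpace.comap (X k) inferInstance)
    (⨆ j ∈ Set.Ici (i + m), MeasurableSpace.comap (X j) inferInstance)

/-- `α_X⁻¹(u) = inf {m : α_{X,m} ≤ u}`, with value `∞` if there is no such `m`. -/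
def rosenblattInv {Ω E : Type*} [MeasurableSpace Ω] [MeasurableSpace E] (P : Measure Ω)
    (X : ℕ → Ω → E) (u : ℝ) : ℝ≥0∞ :=
  ⨅ m ∈ {m : ℕ | rosenblatt P X m ≤ u}, (m : ℝ≥0∞)

/-- Mixing: `M_h = ∫₀¹ (α_X⁻¹(u))^h du < ∞` for every real `h > 0`. -/
def IsMixing {Ω E : Type*} [MeasurableSpace Ω] [MeasurableSpace E] (P : Measure Ω)
    (X : ℕ → Ω → E) : Prop :=
  ∀ h : ℝ, 0 < h → ∫⁻ u in Set.Icc (0 : ℝ) 1, (rosenblattInv P X u) ^ h < ∞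

/-- Stationarity: `(X_{i+1})_i` and `(X_i)_i` have the same law on the sequence space. -/
def IsStationaryProcess {Ω E : Type*} [MeasurableSpace Ω] [MeasurableSpace E] (P : Measure Ω)
    (X : ℕ → Ω → E) : Prop :=
  P.map (fun ω i => X (i + 1) ω) = P.map (fun ω i => X i ω)

/-- The shift `T(x₁, x₂, …) = (x₂, x₃, …)`. -/
def shift {E : Type*} (z : ℕ → E) : ℕ → E := fun i => z (i + 1)

/-- The large deviation principle with (lower semicontinuous) rate function `I`. Here
`expGrowthInf u` and `expGrowthSup u` are the liminf and limsup of `(1/n) log (u n)`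
in `[-∞, ∞]`, with `log 0 = -∞`. -/
structure SatisfiesLDP {Y : Type*} [TopologicalSpace Y] [MeasurableSpace Y]
    (μ : ℕ → Measure Y) (I : Y → ℝ≥0∞) : Prop where
  lsc : LowerSemicontinuous I
  lower : ∀ Γ : Set Y, MeasurableSet Γ →
    -(⨅ x ∈ interior Γ, (I x : EReal)) ≤ ExpGrowth.expGrowthInf (fun n => μ n Γ)
  upper : ∀ Γ : Set Y, MeasurableSet Γ →
    ExpGrowth.expGrowthSup (fun n => μ n Γ) ≤ -(⨅ x ∈ closure Γ, (I x : EReal))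

/-- Exponential tightness: for all `a < ∞` there is a compact `K` with
`limsup (1/n) log μ_n(Kᶜ) ≤ -a`. -/
def ExponentiallyTight {Y : Type*} [TopologicalSpace Y] [MeasurableSpace Y]
    (μ : ℕ → Measure Y) : Prop :=
  ∀ a : ℝ, ∃ K : Set Y, IsCompact K ∧
    ExpGrowth.expGrowthSup (fun n => μ n Kᶜ) ≤ ((-a : ℝ) : EReal)

/-- The functionals `S n` (the index `n = 0` is irrelevant) can be approximated by functions
`S' n` that depend on the first `2n` coordinates only, in the sense that
`sup_z ‖S n z - S' n z‖ / n → 0`. -/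
def HasLocalApprox {E Y : Type*} [NormedAddCommGroup Y] (S : ℕ → (ℕ → E) → Y) : Prop :=
  ∃ S' : ℕ → (ℕ → E) → Y, (∀ n, 1 ≤ n → DependsOn (S' n) (Set.Iio (2 * n))) ∧
    Tendsto (fun n : ℕ => (⨆ z : ℕ → E, ‖S n z - S' n z‖ₑ) / (n : ℝ≥0∞)) atTop (𝓝 0)

/-- The law `μ_n` of `S_n(X) / n`. -/
def meanLaw {Ω E Y : Type*} [MeasurableSpace Ω] [NormedAddCommGroup Y] [NormedSpace ℝ Y]
    [MeasurableSpace Y] (P : Measure Ω) (X : ℕ → Ω → E) (S : ℕ → (ℕ → E) → Y) (n : ℕ) :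
    Measure Y :=
  P.map (fun ω => (n : ℝ)⁻¹ • S n (fun i => X i ω))

/-- The local mean `x_{n,j}(ω) = S_n(T^{(j-1)n} X(ω)) / n` over the `j`-th block, `j ≥ 1`. -/
def blockMean {Ω E Y : Type*} [NormedAddCommGroup Y] [NormedSpace ℝ Y]
    (X : ℕ → Ω → E) (S : ℕ → (ℕ → E) → Y) (n j : ℕ) (ω : Ω) : Y :=
  (n : ℝ)⁻¹ • S n (shift^[(j - 1) * n] (fun i => X i ω))

/-- The empirical measure `μ_n^ω = k(n)⁻¹ ∑_{1 ≤ j ≤ k(n)} δ_{x_{n,j}(ω)}`. -/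
def empiricalMeasure {Ω E Y : Type*} [NormedAddCommGroup Y] [NormedSpace ℝ Y]
    [MeasurableSpace Y] (X : ℕ → Ω → E) (S : ℕ → (ℕ → E) → Y) (k : ℕ → ℕ) (ω : Ω) (n : ℕ) :
    Measure Y :=
  (k n : ℝ≥0∞)⁻¹ • ∑ j ∈ Finset.Icc 1 (k n), Measure.dirac (blockMean X S n j ω)

end LocalFluctuations

end

open LocalFluctuations

namespace LocalFluctuations

open ProbabilityTheory

/-! ### Exponential growth rates and Borel–Cantelli arguments -/

section Growth

/-! By stationarity every block mean has law μ_n, so the empirical measure of a Borel set B has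
expectation exactly μ_n(B). Every upper estimate is then a first-moment argument, without mixing:
`ae_expGrowthSup_le_of_lintegral_le` bounds the growth rate of the random mass by that of its mean.
This gives the upper bounds on balls, exponential tightness, and, since a count below 1 is zero, the
absence of visits when k(n) is too small.

The lower bound is a second-moment argument. When k(n) μ_n(B) is exponentially large, Chebyshev's
inequality (`measure_count_le_half_le`) and Borel–Cantelli (`ae_eventually_half_lt_count`) show that
at least half the expected number of blocks fall near x. Decorrelation comes from
`IsMixing.rosenblatt_le`; it applies because `HasLocalApprox.eventually_dist_freeze_le` replaces
each block mean by a measurable function of 2n variables. -/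

lemma exp_coe_mul_natCast (a : ℝ) (n : ℕ) :
    EReal.exp ((a : EReal) * n) = ENNReal.ofReal (Real.exp (a * n)) := by
  rw [← EReal.exp_coe]
  congr 1

lemma summable_exp_mul_natCast {a : ℝ} (ha : a < 0) :
    Summable (fun n : ℕ => Real.exp (a * n)) := by
  simpa [mul_comm] using Real.summable_exp_nat_mul_iff.2 ha

/-- A first-moment bound controls the almost sure upper exponential growth. -/
lemma ae_expGrowthSup_le_of_lintegral_le {Ω : Type*} [MeasurableSpace Ω] {P : Measure Ω}
    {f : ℕ → Ω → ℝ≥0∞} {c : ℕ → ℝ≥0∞} (hf : ∀ n, 1 ≤ n → Measurable (f n))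
    (hc : ∀ n, 1 ≤ n → ∫⁻ ω, f n ω ∂P ≤ c n) :
    ∀ᵐ ω ∂P, ExpGrowth.expGrowthSup (fun n => f n ω) ≤ ExpGrowth.expGrowthSup c := by
  have key : ∀ b : ℝ, ExpGrowth.expGrowthSup c < b →
      ∀ᵐ ω ∂P, ExpGrowth.expGrowthSup (fun n => f n ω) ≤ b := by
    intro b hb
    obtain ⟨a, ha, hab⟩ := EReal.lt_iff_exists_real_btwn.1 hb
    have hab' : a - b < 0 := by
      have := EReal.coe_lt_coe_iff.1 hab
      linarith
    obtain ⟨N, hN⟩ := eventually_atTop.1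
      ((ExpGrowth.eventually_le_exp ha).and (eventually_ge_atTop 1))
    have hmeas : ∀ n, Measurable
        (fun ω => f (n + N) ω * ENNReal.ofReal (Real.exp (-b * (n + N : ℕ)))) :=
      fun n => (hf _ (hN _ (Nat.le_add_left N n)).2).mul_const _
    -- The expectation of ∑ f_n e^{-bn} is dominated by ∑ e^{(a-b)n}. Hence the series converges
    -- almost surely and its terms are eventually at most 1, that is, f_n ≤ e^{bn}.
    have hfin : ∫⁻ ω, ∑' n, f (n + N) ω * ENNReal.ofReal (Real.exp (-b * (n + N : ℕ))) ∂P ≠ ∞ := by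
      rw [lintegral_tsum fun n => (hmeas n).aemeasurable]
      have hs := (summable_nat_add_iff N).2 (summable_exp_mul_natCast hab')
      refine ne_top_of_le_ne_top hs.tsum_ofReal_ne_top (ENNReal.tsum_le_tsum fun n => ?_)
      have h1 := hN (n + N) (Nat.le_add_left N n)
      rw [lintegral_mul_const _ (hf _ h1.2)]
      calc _ ≤ ENNReal.ofReal (Real.exp (a * (n + N : ℕ))) *
            ENNReal.ofReal (Real.exp (-b * (n + N : ℕ))) := by
            gcongr
            rw [← exp_coe_mul_natCast]
            exact (hc _ h1.2).trans h1.1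
        _ = _ := by
            rw [← ENNReal.ofReal_mul (Real.exp_nonneg _), ← Real.exp_add]
            ring_nf
    filter_upwards [ae_lt_top (Measurable.tsum hmeas) hfin] with ω hω
    have h0 := ENNReal.tendsto_atTop_zero_of_tsum_ne_top hω.ne
    refine Eventually.expGrowthSup_le ?_
    rw [← map_add_atTop_eq_nat N, eventually_map]
    filter_upwards [h0.eventually_le_const one_pos] with n hn
    rw [exp_coe_mul_natCast]
    calc f (n + N) ω = f (n + N) ω * ENNReal.ofReal (Real.exp (-b * (n + N : ℕ))) *
          ENNReal.ofReal (Real.exp (b * (n + N : ℕ))) := by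
          rw [mul_assoc, ← ENNReal.ofReal_mul (Real.exp_nonneg _), ← Real.exp_add]
          simp
      _ ≤ 1 * _ := by gcongr
      _ = _ := one_mul _
  -- Rational thresholds keep the exceptional set null.
  have hall : ∀ᵐ ω ∂P, ∀ q : ℚ, ExpGrowth.expGrowthSup c < ((q : ℝ) : EReal) →
      ExpGrowth.expGrowthSup (fun n => f n ω) ≤ ((q : ℝ) : EReal) := by
    refine ae_all_iff.2 fun q => ?_
    by_cases h : ExpGrowth.expGrowthSup c < ((q : ℝ) : EReal)
    · filter_upwards [key q h] with ω hω _ using hω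
    · exact Eventually.of_forall fun ω h' => absurd h' h
  filter_upwards [hall] with ω hω
  refine le_of_forall_gt fun b hb => ?_
  obtain ⟨q, hq, hqb⟩ := EReal.lt_iff_exists_rat_btwn.1 hb
  exact (hω q hq).trans_lt hqb

lemma ae_eventually_notMem_of_eventually_le {Ω : Type*} [MeasurableSpace Ω] {P : Measure Ω}
    {s : ℕ → Set Ω} {g : ℕ → ℝ} (hg : Summable g)
    (hs : ∀ᶠ n in atTop, P (s n) ≤ ENNReal.ofReal (g n)) :
    ∀ᵐ ω ∂P, ∀ᶠ n in atTop, ω ∉ s n := by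
  obtain ⟨N, hN⟩ := eventually_atTop.1 hs
  have hfin : ∑' n, P (s (n + N)) ≠ ∞ :=
    ne_top_of_le_ne_top ((summable_nat_add_iff N).2 hg).tsum_ofReal_ne_top
      (ENNReal.tsum_le_tsum fun n => hN _ (Nat.le_add_left N n))
  filter_upwards [ae_eventually_notMem hfin] with ω hω
  rw [← map_add_atTop_eq_nat N, eventually_map]
  exact hω

end Growth

/-! ### Second-moment estimates for the number of events that occur -/

section Counting

variable {Ω : Type*} [MeasurableSpace Ω] {P : Measure Ω} [IsProbabilityMeasure P]

lemma covariance_indicator_one {A B : Set Ω} (hA : MeasurableSet A) (hB : MeasurableSet B) :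
    cov[A.indicator (1 : Ω → ℝ), B.indicator 1; P] = P.real (A ∩ B) - P.real A * P.real B := by
  have h : ∀ {A : Set Ω}, MeasurableSet A → MemLp (A.indicator (1 : Ω → ℝ)) 2 P := fun hA =>
    (memLp_const (1 : ℝ)).indicator hA
  rw [covariance_eq_sub (h hA) (h hB), ← Set.inter_indicator_one, integral_indicator_one hA,
    integral_indicator_one hB, integral_indicator_one (hA.inter hB)]

/-- Chebyshev's inequality for the number of events occurring among `K` equiprobable events that
are almost independent when their indices are at distance at least `L`. -/
lemma measure_count_le_half_le {A : ℕ → Set Ω} (hA : ∀ i, MeasurableSet (A i)) {p a : ℝ}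
    (hp : 0 < p) (ha : 0 ≤ a) (hAp : ∀ i, P.real (A i) = p) {K L : ℕ} (hK : 1 ≤ K)
    (hcov : ∀ i j, i + L ≤ j → |P.real (A i) * P.real (A j) - P.real (A i ∩ A j)| ≤ a) :
    P {ω | ∑ i ∈ Finset.range K, (A i).indicator (1 : Ω → ℝ) ω ≤ K * p / 2} ≤
      ENNReal.ofReal (4 * ((2 * L + 1) / (K * p) + a / p ^ 2)) := by
  have hmem : ∀ i ∈ Finset.range K, MemLp ((A i).indicator (1 : Ω → ℝ)) 2 P := fun i _ =>
    (memLp_const (1 : ℝ)).indicator (hA i)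
  set N : Ω → ℝ := ∑ i ∈ Finset.range K, (A i).indicator (1 : Ω → ℝ) with hNdef
  have hNmem : MemLp N 2 P := memLp_finsetSum' _ hmem
  have hK' : (0 : ℝ) < K := by exact_mod_cast hK
  have hmean : P[N] = K * p := by
    simp only [hNdef, Finset.sum_apply]
    rw [integral_finsetSum _ fun i hi => (hmem i hi).integrable (by norm_num)]
    simp [integral_indicator_one (hA _), hAp]
  -- Close pairs cost at most P(A_i) = p, distant pairs at most a. The truncated subtraction i - L
  -- merely cuts the window at 0.
  have hterm : ∀ i j, cov[(A i).indicator (1 : Ω → ℝ), (A j).indicator 1; P] ≤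
      (if j ∈ Finset.Icc (i - L) (i + L) then p else 0) + a := by
    intro i j
    rw [covariance_indicator_one (hA i) (hA j)]
    split_ifs with h
    · have h1 : P.real (A i ∩ A j) ≤ p := (measureReal_mono Set.inter_subset_left).trans (hAp i).le
      have h2 : 0 ≤ P.real (A i) * P.real (A j) := by positivity
      linarith
    · rw [zero_add]
      have h' : i + L ≤ j ∨ j + L ≤ i := by
        rw [Finset.mem_Icc] at h
        omega
      rcases h' with h' | h'
      · have := (abs_le.1 (hcov i j h')).1
        linarith
      · have := (abs_le.1 (hcov j i h')).1
        rw [Set.inter_comm, mul_comm]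
        linarith
  have hvar : Var[N; P] ≤ K * ((2 * L + 1) * p + K * a) := by
    rw [hNdef, variance_sum' hmem]
    calc _ ≤ ∑ i ∈ Finset.range K, ((2 * L + 1) * p + K * a) := by
          refine Finset.sum_le_sum fun i _ => ?_
          refine (Finset.sum_le_sum fun j _ => hterm i j).trans ?_
          rw [Finset.sum_add_distrib, ← Finset.sum_filter]
          simp only [Finset.sum_const, nsmul_eq_mul, Finset.card_range]
          gcongr
          have : ((Finset.range K).filter (· ∈ Finset.Icc (i - L) (i + L))).card ≤ 2 * L + 1 := by
            refine (Finset.card_le_card (t := Finset.Icc (i - L) (i + L)) fun x hx => ?_).trans ?_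
            · exact (Finset.mem_filter.1 hx).2
            · rw [Nat.card_Icc]
              omega
          exact_mod_cast this
      _ = _ := by rw [Finset.sum_const, Finset.card_range, nsmul_eq_mul]
  have hc : 0 < K * p / 2 := by positivity
  calc _ ≤ P {ω | K * p / 2 ≤ |N ω - P[N]|} := by
        refine measure_mono fun ω hω => ?_
        simp only [Set.mem_ofPred_eq] at hω ⊢
        have hω' : N ω ≤ K * p / 2 := by simpa [hNdef] using hω
        rw [hmean, abs_sub_comm]
        refine le_trans ?_ (le_abs_self _)
        linarith
    _ ≤ ENNReal.ofReal (Var[N; P] / (K * p / 2) ^ 2) := meas_ge_le_variance_div_sq hNmem hc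
    _ ≤ _ := by
        refine ENNReal.ofReal_le_ofReal ?_
        calc _ ≤ (K * ((2 * L + 1) * p + K * a)) / (K * p / 2) ^ 2 := by gcongr
          _ = _ := by
            field_simp
            norm_num

/-- If the number of events is exponentially larger than the inverse of their probability, and the
correlation coefficients decay faster than any polynomial, then almost surely at least half of
the expected number of events occur eventually. -/
lemma ae_eventually_half_lt_count {A : ℕ → ℕ → Set Ω} (hA : ∀ n, 1 ≤ n → ∀ i, MeasurableSet (A n i))
    {p α : ℕ → ℝ} {K : ℕ → ℕ} (hAp : ∀ n, 1 ≤ n → ∀ i, P.real (A n i) = p n)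
    (hα : ∀ h : ℝ, 0 < h → ∃ M : ℝ, 0 ≤ M ∧ ∀ m : ℕ, 1 ≤ m → α m ≤ M * (m : ℝ) ^ (-h))
    (hcov : ∀ n, 1 ≤ n → ∀ L, 1 ≤ L → ∀ i j, i + (L + 2) ≤ j →
      |P.real (A n i) * P.real (A n j) - P.real (A n i ∩ A n j)| ≤ α L)
    {c η : ℝ} (hc : 0 ≤ c) (hη : 0 < η)
    (hp : ∀ᶠ n : ℕ in atTop, Real.exp (-(c + η) * n) ≤ p n)
    (hK : ∀ᶠ n : ℕ in atTop, Real.exp ((c + 3 * η) * n) ≤ K n) :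
    ∀ᵐ ω ∂P, ∀ᶠ n in atTop,
      K n * p n / 2 < ∑ i ∈ Finset.range (K n), (A n i).indicator (1 : Ω → ℝ) ω := by
  -- Chosen so that -ηh + 2(c + η) = -1: with L ≥ e^{ηn}, the ratio α_L / p_n² is then at most M
  -- e^{-n}.
  set h : ℝ := (2 * (c + η) + 1) / η with hh
  obtain ⟨M, hM0, hM⟩ := hα h (by positivity)
  have hsum : Summable fun n : ℕ =>
      4 * (9 * Real.exp (-η * n) + M * Real.exp (-1 * n)) :=
    (((summable_exp_mul_natCast (neg_lt_zero.2 hη)).mul_left 9).add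
      ((summable_exp_mul_natCast (by norm_num)).mul_left M)).mul_left 4
  have := ae_eventually_notMem_of_eventually_le (P := P) (s := fun n =>
    {ω | ∑ i ∈ Finset.range (K n), (A n i).indicator (1 : Ω → ℝ) ω ≤ K n * p n / 2}) hsum ?_
  · simpa only [Set.mem_ofPred_eq, not_le] using this
  filter_upwards [hp, hK, eventually_ge_atTop 1] with n hpn hKn hn
  -- This gap is negligible against K p ≥ e^{2ηn}, yet large enough to turn polynomial decay of α
  -- into exponential decay in n.
  set L : ℕ := ⌈Real.exp (η * n)⌉₊ with hL
  have hE : 1 ≤ Real.exp (η * n) := Real.one_le_exp (by positivity)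
  have hLge : Real.exp (η * n) ≤ L := Nat.le_ceil _
  have hLle : (L : ℝ) ≤ 2 * Real.exp (η * n) := by
    have := Nat.ceil_lt_add_one (Real.exp_nonneg (η * n))
    linarith
  have hL1 : 1 ≤ L := by exact_mod_cast hE.trans hLge
  have hp0 : 0 < p n := (Real.exp_pos _).trans_le hpn
  have hK0 : (0 : ℝ) < K n := (Real.exp_pos _).trans_le hKn
  have hα0 : 0 ≤ α L := (abs_nonneg _).trans (hcov n hn L hL1 0 (L + 2) (by omega))
  refine (measure_count_le_half_le (hA n hn) hp0 hα0 (hAp n hn) (K := K n) (L := L + 2)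
    (by exact_mod_cast hK0) (hcov n hn L hL1)).trans (ENNReal.ofReal_le_ofReal ?_)
  have hKp : Real.exp (2 * η * n) ≤ K n * p n := by
    calc Real.exp (2 * η * n) = Real.exp ((c + 3 * η) * n) * Real.exp (-(c + η) * n) := by
          rw [← Real.exp_add]
          ring_nf
      _ ≤ _ := by gcongr
  have h1 : (2 * ((L + 2 : ℕ) : ℝ) + 1) / (K n * p n) ≤ 9 * Real.exp (-η * n) := by
    calc _ ≤ (9 * Real.exp (η * n)) / Real.exp (2 * η * n) := by
          gcongr
          push_cast
          linarith
      _ = _ := by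
          rw [mul_div_assoc, ← Real.exp_sub]
          ring_nf
  have h2 : α L / p n ^ 2 ≤ M * Real.exp (-1 * n) := by
    calc α L / p n ^ 2 ≤ (M * Real.exp (η * n) ^ (-h)) / Real.exp (-(c + η) * n) ^ 2 := by
          gcongr
          refine (hM L hL1).trans ?_
          gcongr M * ?_
          exact Real.rpow_le_rpow_of_nonpos (Real.exp_pos _) hLge (by
            rw [neg_nonpos]
            positivity)
      _ = _ := by
          rw [← Real.exp_mul, ← Real.exp_nat_mul, mul_div_assoc, ← Real.exp_sub]
          congr 2
          rw [hh]
          field_simp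
          push_cast
          ring
  gcongr

end Counting

/-! ### Rosenblatt coefficients -/

section Mixing

lemma alphaCoeff_le {Ω : Type*} {mΩ : MeasurableSpace Ω} {P : Measure Ω}
    {𝒰 𝒱 : MeasurableSpace Ω} {c : ℝ}
    (h : ∀ U V : Set Ω, MeasurableSet[𝒰] U → MeasurableSet[𝒱] V →
      |P.real U * P.real V - P.real (U ∩ V)| ≤ c) :
    @alphaCoeff Ω mΩ P 𝒰 𝒱 ≤ c := by
  refine csSup_le ⟨_, ∅, ∅, @MeasurableSet.empty _ 𝒰, @MeasurableSet.empty _ 𝒱, rfl⟩ ?_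
  rintro _ ⟨U, V, hU, hV, rfl⟩
  exact h U V hU hV

variable {Ω E : Type*} {mΩ : MeasurableSpace Ω} [MeasurableSpace E] {P : Measure Ω}
  [IsProbabilityMeasure P] {X : ℕ → Ω → E}

lemma abs_mul_sub_inter_le_one (P : Measure Ω) [IsProbabilityMeasure P] (U V : Set Ω) :
    |P.real U * P.real V - P.real (U ∩ V)| ≤ 1 := by
  have h1 : P.real U ≤ 1 := measureReal_le_one
  have h2 : P.real V ≤ 1 := measureReal_le_one
  have h3 : P.real (U ∩ V) ≤ 1 := measureReal_le_one
  have h4 : P.real U * P.real V ≤ 1 := mul_le_one₀ h1 measureReal_nonneg h2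
  have h5 : 0 ≤ P.real U * P.real V := by positivity
  have h6 : 0 ≤ P.real (U ∩ V) := measureReal_nonneg
  rw [abs_le]
  constructor <;> linarith

lemma bddAbove_alphaCoeff_set (P : Measure Ω) [IsProbabilityMeasure P] (𝒰 𝒱 : MeasurableSpace Ω) :
    BddAbove {r : ℝ | ∃ U V : Set Ω, MeasurableSet[𝒰] U ∧ MeasurableSet[𝒱] V ∧
      r = |P.real U * P.real V - P.real (U ∩ V)|} := by
  refine ⟨1, ?_⟩
  rintro _ ⟨U, V, -, -, rfl⟩
  exact abs_mul_sub_inter_le_one P U V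

lemma le_alphaCoeff {𝒰 𝒱 : MeasurableSpace Ω} {U V : Set Ω} (hU : MeasurableSet[𝒰] U)
    (hV : MeasurableSet[𝒱] V) :
    |P.real U * P.real V - P.real (U ∩ V)| ≤ @alphaCoeff Ω mΩ P 𝒰 𝒱 :=
  le_csSup (bddAbove_alphaCoeff_set P 𝒰 𝒱) ⟨U, V, hU, hV, rfl⟩

lemma alphaCoeff_le_rosenblatt {m : ℕ} (hm : 1 ≤ m) (i : ℕ) :
    alphaCoeff P (⨆ k ∈ Set.Iic i, MeasurableSpace.comap (X k) inferInstance)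
      (⨆ j ∈ Set.Ici (i + m), MeasurableSpace.comap (X j) inferInstance) ≤ rosenblatt P X m := by
  rw [rosenblatt, if_neg (by omega)]
  refine le_ciSup (f := fun i : ℕ => alphaCoeff P
    (⨆ k ∈ Set.Iic i, MeasurableSpace.comap (X k) inferInstance)
    (⨆ j ∈ Set.Ici (i + m), MeasurableSpace.comap (X j) inferInstance)) ⟨1, ?_⟩ i
  rintro _ ⟨i, rfl⟩
  exact alphaCoeff_le fun U V _ _ => abs_mul_sub_inter_le_one P U V

lemma rosenblatt_le_one {m : ℕ} (hm : 1 ≤ m) : rosenblatt P X m ≤ 1 := by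
  rw [rosenblatt, if_neg (by omega)]
  exact ciSup_le fun i => alphaCoeff_le fun U V _ _ => abs_mul_sub_inter_le_one P U V

/-- A larger gap shrinks the σ-algebra of the future. Index 0 is left out because its value 1/2 is a
convention. -/
lemma rosenblatt_antitone {l m : ℕ} (hl : 1 ≤ l) (hlm : l ≤ m) :
    rosenblatt P X m ≤ rosenblatt P X l := by
  rw [rosenblatt, if_neg (by omega)]
  refine ciSup_le fun i => le_trans ?_ (alphaCoeff_le_rosenblatt hl i)
  refine alphaCoeff_le fun U V hU hV => le_alphaCoeff hU ?_
  refine (biSup_mono fun j hj => ?_ : (⨆ j ∈ Set.Ici (i + m), MeasurableSpace.comap (X j)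
    inferInstance) ≤ ⨆ j ∈ Set.Ici (i + l), MeasurableSpace.comap (X j) inferInstance) V hV
  rw [Set.mem_Ici] at hj ⊢
  omega

/-- Under the mixing condition, the Rosenblatt coefficients decay faster than any polynomial. -/
lemma IsMixing.rosenblatt_le (hX : IsMixing P X) {h : ℝ} (hh : 0 < h) :
    ∃ M : ℝ, 0 ≤ M ∧ ∀ m : ℕ, 1 ≤ m → rosenblatt P X m ≤ M * (m : ℝ) ^ (-h) := by
  set J := ∫⁻ u in Set.Icc (0 : ℝ) 1, (rosenblattInv P X u) ^ h with hJ
  have hJfin : J < ∞ := hX h hh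
  refine ⟨2 * J.toReal, by positivity, fun m hm => ?_⟩
  set a := rosenblatt P X m with ha
  have ha1 : a ≤ 1 := rosenblatt_le_one hm
  have hm0 : (0 : ℝ) < m := by exact_mod_cast hm
  rcases le_or_gt a 0 with ha0 | ha0
  · exact ha0.trans (by positivity)
  -- Below a/2 ≤ 1/2 the index 0 is excluded by its value 1/2, and the indices 1 ≤ l < m by
  -- monotonicity. Integrating over (0, a/2) gives m^h a/2 ≤ J, whence the constant 2J.
  have hinv : ∀ u ∈ Set.Ioo (0 : ℝ) (a / 2), ((m : ℝ≥0∞)) ≤ rosenblattInv P X u := by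
    intro u hu
    refine le_iInf₂ fun l hl => ?_
    by_contra! hlm
    have hlm' : l < m := by exact_mod_cast hlm
    have hl' : rosenblatt P X l ≤ u := hl
    have hu2 := hu.2
    rcases Nat.eq_zero_or_pos l with rfl | hl0
    · rw [rosenblatt, if_pos rfl] at hl'
      linarith
    · have := rosenblatt_antitone (P := P) (X := X) hl0 hlm'.le
      linarith
  have hle : (m : ℝ≥0∞) ^ h * ENNReal.ofReal (a / 2) ≤ J := by
    calc (m : ℝ≥0∞) ^ h * ENNReal.ofReal (a / 2)
        = ∫⁻ _ in Set.Ioo (0 : ℝ) (a / 2), (m : ℝ≥0∞) ^ h := by simp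
      _ ≤ ∫⁻ u in Set.Ioo (0 : ℝ) (a / 2), (rosenblattInv P X u) ^ h :=
          setLIntegral_mono' measurableSet_Ioo fun u hu =>
            ENNReal.rpow_le_rpow (hinv u hu) hh.le
      _ ≤ J := lintegral_mono_set fun u hu => ⟨hu.1.le, by linarith [hu.2]⟩
  have hle' := ENNReal.toReal_mono hJfin.ne hle
  rw [ENNReal.toReal_mul, ENNReal.toReal_ofReal (by linarith), ← ENNReal.toReal_rpow,
    ENNReal.toReal_natCast] at hle'
  rw [Real.rpow_neg hm0.le, ← div_eq_mul_inv, le_div_iff₀ (by positivity)]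
  linarith

end Mixing

/-! ### Block means, their laws and the empirical measures -/

section Blocks

lemma shift_iterate_apply {E : Type*} (m : ℕ) (z : ℕ → E) (i : ℕ) : shift^[m] z i = z (i + m) := by
  induction m generalizing z with
  | zero => rfl
  | succ m ih =>
    rw [Function.iterate_succ_apply, ih, shift, add_assoc]

/-- The sequence that agrees with `z` before time `m` and is constant equal to `e` afterwards. -/
def freeze {E : Type*} (e : E) (m : ℕ) (z : ℕ → E) : ℕ → E := fun i => if i < m then z i else e

/-- The approximations S'_n need not be measurable, but S_n composed with `freeze` is when S_n is,
and it also sees only 2n coordinates. Since S'_n does not notice the freezing, the triangle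
inequality through S'_n z compares the two. -/
lemma HasLocalApprox.eventually_dist_freeze_le {E Y : Type*} [NormedAddCommGroup Y]
    [NormedSpace ℝ Y] {S : ℕ → (ℕ → E) → Y} (hA : HasLocalApprox S) (e : E) {δ : ℝ}
    (hδ : 0 < δ) :
    ∀ᶠ n : ℕ in atTop, ∀ z : ℕ → E,
      dist ((n : ℝ)⁻¹ • S n z) ((n : ℝ)⁻¹ • S n (freeze e (2 * n) z)) ≤ δ := by
  obtain ⟨S', hS', hlim⟩ := hA
  have hδ' : (0 : ℝ≥0∞) < ENNReal.ofReal (δ / 2) := by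
    rw [ENNReal.ofReal_pos]
    linarith
  filter_upwards [hlim.eventually_lt_const hδ', eventually_ge_atTop 1] with n hn hn1 z
  have hn0 : (0 : ℝ) < n := by exact_mod_cast hn1
  have hbound : ∀ z, ‖S n z - S' n z‖ ≤ n * (δ / 2) := by
    intro z
    have h1 : ‖S n z - S' n z‖ₑ / n ≤ ENNReal.ofReal (δ / 2) :=
      (ENNReal.div_le_div_right (le_iSup (fun z => ‖S n z - S' n z‖ₑ) z) _).trans hn.le
    rw [ENNReal.div_le_iff (by exact_mod_cast hn0.ne') (ENNReal.natCast_ne_top n),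
      ← ofReal_norm, ← ENNReal.ofReal_natCast, ← ENNReal.ofReal_mul (by positivity),
      ENNReal.ofReal_le_ofReal_iff (by positivity)] at h1
    linarith
  have heq : S' n (freeze e (2 * n) z) = S' n z := hS' n hn1 fun i hi => if_pos hi
  have h1 := hbound z
  have h2 := hbound (freeze e (2 * n) z)
  rw [heq, ← dist_eq_norm] at h2
  rw [← dist_eq_norm] at h1
  have h3 := dist_triangle_right (S n z) (S n (freeze e (2 * n) z)) (S' n z)
  rw [dist_smul₀, Real.norm_of_nonneg (by positivity), inv_mul_le_iff₀ hn0]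
  linarith

lemma measurable_freeze_shift_iterate {Ω E : Type*} [MeasurableSpace E]
    {m : MeasurableSpace Ω} {X : ℕ → Ω → E} (e : E) (l r : ℕ)
    (hX : ∀ i, l ≤ i → i < l + r → Measurable[m] (X i)) :
    Measurable[m] fun ω => freeze e r (shift^[l] fun i => X i ω) := by
  refine measurable_pi_lambda _ fun i => ?_
  simp only [freeze, shift_iterate_apply]
  split_ifs with hi
  · exact hX _ (Nat.le_add_left l i) (by omega)
  · exact measurable_const

lemma empiricalMeasure_apply {Ω E Y : Type*} [NormedAddCommGroup Y] [NormedSpace ℝ Y]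
    [MeasurableSpace Y] {X : ℕ → Ω → E} {S : ℕ → (ℕ → E) → Y} {k : ℕ → ℕ} (ω : Ω) (n : ℕ) {B : Set Y} (hB : MeasurableSet B) :
    empiricalMeasure X S k ω n B =
      (k n : ℝ≥0∞)⁻¹ * ∑ j ∈ Finset.Icc 1 (k n), B.indicator 1 (blockMean X S n j ω) := by
  simp [empiricalMeasure, Measure.dirac_apply' _ hB]

/-- Lower semicontinuity keeps I above a on a whole ball around x, so the upper bound applies to
smaller closed balls. -/
lemma SatisfiesLDP.eventually_expGrowthSup_closedBall_le {Y : Type*} [NormedAddCommGroup Y]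
    [MeasurableSpace Y] [BorelSpace Y] {μ : ℕ → Measure Y} {I : Y → ℝ≥0∞}
    (h : SatisfiesLDP μ I) {x : Y} {a : EReal} (ha : a < I x) :
    ∀ᶠ ε in 𝓝[>] (0 : ℝ),
      ExpGrowth.expGrowthSup (fun n => μ n (Metric.closedBall x ε)) ≤ -a := by
  have hlsc : LowerSemicontinuous fun y => (I y : EReal) :=
    continuous_coe_ennreal_ereal.comp_lowerSemicontinuous h.lsc
      fun a b hab => EReal.coe_ennreal_le_coe_ennreal_iff.2 hab
  obtain ⟨δ, hδ, hball⟩ := Metric.eventually_nhds_iff_ball.1 (hlsc x a ha)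
  filter_upwards [Ioo_mem_nhdsGT hδ] with ε hε
  refine (h.upper _ Metric.isClosed_closedBall.measurableSet).trans ?_
  rw [EReal.neg_le_neg_iff, Metric.isClosed_closedBall.closure_eq]
  exact le_iInf₂ fun y hy => (hball y (Metric.closedBall_subset_ball hε.2 hy)).le

variable {Ω E Y : Type*} [MeasurableSpace Ω] [MeasurableSpace E]

lemma measurable_shift_iterate (m : ℕ) : Measurable (shift^[m] : (ℕ → E) → ℕ → E) := by
  refine measurable_pi_lambda _ fun i => ?_
  simp only [shift_iterate_apply]
  exact measurable_pi_apply _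

lemma IsStationaryProcess.map_shift_iterate {P : Measure Ω} {X : ℕ → Ω → E}
    (hstat : IsStationaryProcess P X) (hX : ∀ i, Measurable (X i)) (m : ℕ) :
    P.map (fun ω => shift^[m] (fun i => X i ω)) = P.map (fun ω i => X i ω) := by
  induction m with
  | zero => rfl
  | succ m ih =>
    have hpath : Measurable fun ω i => X i ω := measurable_pi_lambda _ hX
    have hpath' : Measurable fun ω i => X (i + 1) ω := measurable_pi_lambda _ fun i => hX (i + 1)
    rw [← ih]
    have h1 : (fun ω => shift^[m + 1] (fun i => X i ω)) =
        shift^[m] ∘ fun ω i => X (i + 1) ω := by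
      ext ω
      rw [Function.iterate_succ_apply]
      rfl
    have h2 : (fun ω => shift^[m] (fun i => X i ω)) = shift^[m] ∘ fun ω i => X i ω := rfl
    rw [h1, h2, ← Measure.map_map (measurable_shift_iterate m) hpath',
      ← Measure.map_map (measurable_shift_iterate m) hpath, hstat]

lemma IsStationaryProcess.measure_shift_iterate_mem {P : Measure Ω} {X : ℕ → Ω → E}
    (hstat : IsStationaryProcess P X) (hX : ∀ i, Measurable (X i)) (m : ℕ) {D : Set (ℕ → E)}
    (hD : MeasurableSet D) :
    P {ω | shift^[m] (fun i => X i ω) ∈ D} = P {ω | (fun i => X i ω) ∈ D} := by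
  have hpath : Measurable fun ω i => X i ω := measurable_pi_lambda _ hX
  have h := congrArg (fun ν => ν D) (hstat.map_shift_iterate hX m)
  have h1 := Measure.map_apply (μ := P) ((measurable_shift_iterate m).comp hpath) hD
  exact h1.symm.trans (h.trans (Measure.map_apply hpath hD))

variable [NormedAddCommGroup Y] [NormedSpace ℝ Y] [MeasurableSpace Y] [BorelSpace Y]
  {P : Measure Ω} {X : ℕ → Ω → E} {S : ℕ → (ℕ → E) → Y} {k : ℕ → ℕ}

lemma measurable_blockMean (hX : ∀ i, Measurable (X i)) {n : ℕ} (hS : Measurable (S n)) (j : ℕ) :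
    Measurable (blockMean X S n j) :=
  (hS.comp ((measurable_shift_iterate _).comp (measurable_pi_lambda _ hX))).const_smul _

lemma meanLaw_apply (hX : ∀ i, Measurable (X i)) {n : ℕ} (hS : Measurable (S n)) {B : Set Y}
    (hB : MeasurableSet B) :
    meanLaw P X S n B = P {ω | (n : ℝ)⁻¹ • S n (fun i => X i ω) ∈ B} :=
  Measure.map_apply ((hS.comp (measurable_pi_lambda _ hX)).const_smul _) hB

lemma measure_blockMean_mem (hX : ∀ i, Measurable (X i)) (hstat : IsStationaryProcess P X)
    {n : ℕ} (hS : Measurable (S n)) (j : ℕ) {B : Set Y} (hB : MeasurableSet B) :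
    P (blockMean X S n j ⁻¹' B) = meanLaw P X S n B := by
  rw [meanLaw_apply hX hS hB]
  exact hstat.measure_shift_iterate_mem hX _ (hS.const_smul (n : ℝ)⁻¹ hB)

lemma measurable_indicator_blockMean (hX : ∀ i, Measurable (X i)) {n : ℕ}
    (hS : Measurable (S n)) (j : ℕ) {B : Set Y} (hB : MeasurableSet B) :
    Measurable fun ω => B.indicator (1 : Y → ℝ≥0∞) (blockMean X S n j ω) :=
  (measurable_one.indicator hB).comp (measurable_blockMean hX hS j)

lemma lintegral_count (hX : ∀ i, Measurable (X i)) (hstat : IsStationaryProcess P X)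
    {n : ℕ} (hS : Measurable (S n)) {B : Set Y} (hB : MeasurableSet B) :
    ∫⁻ ω, ∑ j ∈ Finset.Icc 1 (k n), B.indicator 1 (blockMean X S n j ω) ∂P =
      k n * meanLaw P X S n B := by
  rw [lintegral_finsetSum _ fun j _ => measurable_indicator_blockMean hX hS j hB]
  have : ∀ j, ∫⁻ ω, B.indicator 1 (blockMean X S n j ω) ∂P = meanLaw P X S n B := fun j => by
    rw [← measure_blockMean_mem hX hstat hS j hB,
      ← lintegral_indicator_one (measurable_blockMean hX hS j hB)]
    rfl
  simp [this]

lemma ae_expGrowthSup_empiricalMeasure_le (hX : ∀ i, Measurable (X i))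
    (hstat : IsStationaryProcess P X) (hS : ∀ n, 1 ≤ n → Measurable (S n))
    (hk : ∀ n, 1 ≤ n → 1 ≤ k n) {B : Set Y} (hB : MeasurableSet B) :
    ∀ᵐ ω ∂P, ExpGrowth.expGrowthSup (fun n => empiricalMeasure X S k ω n B) ≤
      ExpGrowth.expGrowthSup (fun n => meanLaw P X S n B) := by
  simp only [empiricalMeasure_apply _ _ hB]
  refine ae_expGrowthSup_le_of_lintegral_le (fun n hn => ?_) fun n hn => ?_
  · exact (Finset.measurable_sum _
      fun j _ => measurable_indicator_blockMean hX (hS n hn) j hB).const_mul _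
  · rw [lintegral_const_mul _ (Finset.measurable_sum _
      fun j _ => measurable_indicator_blockMean hX (hS n hn) j hB),
      lintegral_count hX hstat (hS n hn) hB, ← mul_assoc, ENNReal.inv_mul_cancel, one_mul]
    · exact_mod_cast Nat.one_le_iff_ne_zero.1 (hk n hn)
    · exact ENNReal.natCast_ne_top _

/-- The radii 1/(m+1) suffice by monotonicity in ε, so one null set serves all b and ε. -/
lemma ae_eventually_expGrowthSup_empiricalMeasure_lt (hX : ∀ i, Measurable (X i))
    (hstat : IsStationaryProcess P X) (hS : ∀ n, 1 ≤ n → Measurable (S n))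
    (hk : ∀ n, 1 ≤ n → 1 ≤ k n) {I : Y → ℝ≥0∞} (hI : SatisfiesLDP (meanLaw P X S) I) (x : Y) :
    ∀ᵐ ω ∂P, ∀ b : EReal, -(I x : EReal) < b → ∀ᶠ ε in 𝓝[>] (0 : ℝ),
      ExpGrowth.expGrowthSup
        (fun n => empiricalMeasure X S k ω n (Metric.closedBall x ε)) < b := by
  have hall := ae_all_iff.2 fun m : ℕ => ae_expGrowthSup_empiricalMeasure_le hX hstat hS hk
    (Metric.isClosed_closedBall.measurableSet : MeasurableSet (Metric.closedBall x (1 / (m + 1))))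
  filter_upwards [hall] with ω hω b hb
  obtain ⟨a, hba, ha⟩ := exists_between (EReal.neg_lt_comm.1 hb)
  obtain ⟨δ, hδ, hsub⟩ :=
    mem_nhdsGT_iff_exists_Ioo_subset.1 (hI.eventually_expGrowthSup_closedBall_le ha)
  obtain ⟨m, hm⟩ := exists_nat_one_div_lt (Set.mem_Ioi.1 hδ)
  have hm0 : (0 : ℝ) < 1 / (m + 1) := by positivity
  filter_upwards [Ioo_mem_nhdsGT hm0] with ε hε
  calc _ ≤ ExpGrowth.expGrowthSup
        (fun n => empiricalMeasure X S k ω n (Metric.closedBall x (1 / (m + 1)))) :=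
        ExpGrowth.expGrowthSup_monotone fun n =>
          measure_mono (Metric.closedBall_subset_closedBall hε.2.le)
    _ ≤ _ := hω m
    _ ≤ -a := hsub ⟨hm0, hm⟩
    _ < b := EReal.neg_lt_comm.1 hba

/-- If there are exponentially fewer blocks than needed to see a deviation towards `x`, then
almost surely no block mean is eventually close to `x`. -/
lemma exists_ae_eventually_blockMean_notMem (hX : ∀ i, Measurable (X i))
    (hstat : IsStationaryProcess P X) (hS : ∀ n, 1 ≤ n → Measurable (S n))
    {I : Y → ℝ≥0∞} (hI : SatisfiesLDP (meanLaw P X S) I) {x : Y}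
    (hx : ExpGrowth.expGrowthSup (fun n => (k n : ℝ≥0∞)) < (I x : EReal)) :
    ∃ ε : ℝ, 0 < ε ∧ ∀ᵐ ω ∂P, ∀ᶠ n in atTop,
      {j : ℕ | 1 ≤ j ∧ j ≤ k n ∧ blockMean X S n j ω ∈ Metric.closedBall x ε} = ∅ := by
  obtain ⟨a, hka, ha⟩ := EReal.lt_iff_exists_real_btwn.1 hx
  obtain ⟨ε, hε, hε0⟩ := ((hI.eventually_expGrowthSup_closedBall_le ha).and
    self_mem_nhdsWithin).exists
  refine ⟨ε, hε0, ?_⟩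
  have hB : MeasurableSet (Metric.closedBall x ε) := Metric.isClosed_closedBall.measurableSet
  set v : ℕ → ℝ≥0∞ := fun n => meanLaw P X S n (Metric.closedBall x ε) with hv
  -- The expected number of visits k(n) μ_n(B) decays exponentially. The side conditions exclude ⊤,
  -- since the rate of v may be ⊥.
  have hneg : ExpGrowth.expGrowthSup ((fun n => (k n : ℝ≥0∞)) * v) < 0 := by
    calc _ ≤ ExpGrowth.expGrowthSup (fun n => (k n : ℝ≥0∞)) + ExpGrowth.expGrowthSup v := by
          refine ExpGrowth.expGrowthSup_mul_le (Or.inr ?_) (Or.inl hka.ne_top)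
          exact (hε.trans_lt (EReal.coe_lt_top (-a))).ne
      _ ≤ ExpGrowth.expGrowthSup (fun n => (k n : ℝ≥0∞)) + ((-a : ℝ) : EReal) := by
          gcongr
          exact hε
      _ < (a : EReal) + ((-a : ℝ) : EReal) := EReal.add_lt_add_right_coe hka _
      _ = 0 := by
          rw [← EReal.coe_add]
          simp
  obtain ⟨b, hb, hb0⟩ := EReal.lt_iff_exists_real_btwn.1 hneg
  filter_upwards [ae_expGrowthSup_le_of_lintegral_le (P := P)
    (c := (fun n => (k n : ℝ≥0∞)) * v)
    (fun n hn => Finset.measurable_sum (Finset.Icc 1 (k n))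
      fun j _ => measurable_indicator_blockMean hX (hS n hn) j hB)
    (fun n hn => (lintegral_count hX hstat (hS n hn) hB).le)] with ω hω
  filter_upwards [ExpGrowth.eventually_le_exp (hω.trans_lt hb), eventually_ge_atTop 1] with n hn hn1
  rw [Set.eq_empty_iff_forall_notMem]
  rintro j ⟨hj1, hjk, hj⟩
  -- One visit already makes the count at least 1, which exceeds e^{bn} as b < 0.
  have h1 : (1 : ℝ≥0∞) ≤ EReal.exp (b * n) := by
    refine le_trans ?_ hn
    refine le_trans ?_ (Finset.single_le_sum (fun _ _ => zero_le) (Finset.mem_Icc.2 ⟨hj1, hjk⟩))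
    simp [Set.indicator_of_mem hj]
  rw [exp_coe_mul_natCast, ENNReal.one_le_ofReal, Real.one_le_exp_iff] at h1
  have hb0' : b < 0 := by exact_mod_cast hb0
  have hn1' : (0 : ℝ) < n := by exact_mod_cast hn1
  nlinarith

/-- Almost sure lower bound on the empirical measure of a ball around `x`, when there are
sufficiently many blocks. -/
lemma ae_le_expGrowthInf_empiricalMeasure [IsProbabilityMeasure P] (hX : ∀ i, Measurable (X i))
    (hstat : IsStationaryProcess P X) (hS : ∀ n, 1 ≤ n → Measurable (S n))
    {I : Y → ℝ≥0∞} (hI : SatisfiesLDP (meanLaw P X S) I) (hmix : IsMixing P X)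
    (happ : HasLocalApprox S) {x : Y} (hx : I x < ∞)
    (hkx : (I x : EReal) < ExpGrowth.expGrowthInf (fun n => (k n : ℝ≥0∞)))
    {ε : ℝ} (hε : 0 < ε) :
    ∀ᵐ ω ∂P, -(I x : EReal) ≤ ExpGrowth.expGrowthInf
      (fun n => empiricalMeasure X S k ω n (Metric.closedBall x ε)) := by
  obtain ⟨ω₀⟩ := nonempty_of_isProbabilityMeasure P
  set e : E := X 0 ω₀
  set c : ℝ := (I x).toReal with hc
  have hc0 : 0 ≤ c := ENNReal.toReal_nonneg
  have hcI : (I x : EReal) = (c : EReal) := (EReal.coe_ennreal_toReal hx.ne).symm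
  obtain ⟨b, hcb, hbk⟩ := EReal.lt_iff_exists_real_btwn.1 hkx
  have hcb' : c < b := by
    rw [hcI] at hcb
    exact_mod_cast hcb
  set η : ℝ := (b - c) / 3 with hη
  have hη0 : 0 < η := by
    rw [hη]
    linarith
  have hbη : b = c + 3 * η := by
    rw [hη]
    ring
  have hε3 : 0 < ε / 3 := by positivity
  have hlow : -(I x : EReal) ≤
      ExpGrowth.expGrowthInf (fun n => meanLaw P X S n (Metric.ball x (ε / 3))) := by
    refine le_trans ?_ (hI.lower _ Metric.isOpen_ball.measurableSet)
    rw [EReal.neg_le_neg_iff, Metric.isOpen_ball.interior_eq]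
    exact iInf₂_le x (Metric.mem_ball_self hε3)
  -- Freezing costs ε/3 twice: from the ball of radius ε/3 for the law to B, then from B back to
  -- radius ε for the true block mean.
  set B : Set Y := Metric.closedBall x (2 * ε / 3) with hBdef
  have hB : MeasurableSet B := Metric.isClosed_closedBall.measurableSet
  set A : ℕ → ℕ → Set Ω := fun n i =>
    {ω | (n : ℝ)⁻¹ • S n (freeze e (2 * n) (shift^[i * n] fun l => X l ω)) ∈ B} with hA
  -- The σ-algebra is left free: it will be the ambient one, then the past and the future of the
  -- mixing coefficient.
  have hAmeas : ∀ (m : MeasurableSpace Ω) (n : ℕ), 1 ≤ n → ∀ i,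
      (∀ l, i * n ≤ l → l < i * n + 2 * n → Measurable[m] (X l)) → MeasurableSet[m] (A n i) :=
    fun m n hn i h =>
      (((hS n hn).const_smul (n : ℝ)⁻¹).comp (measurable_freeze_shift_iterate e _ _ h)) hB
  have hfreeze : ∀ r, Measurable (freeze e r) := fun r =>
    measurable_freeze_shift_iterate (X := fun i (z : ℕ → E) => z i) e 0 r
      fun i _ _ => measurable_pi_apply i
  have hstatA : ∀ n, 1 ≤ n → ∀ i, P.real (A n i) = P.real (A n 0) := by
    intro n hn i
    have hD : MeasurableSet {z : ℕ → E | (n : ℝ)⁻¹ • S n (freeze e (2 * n) z) ∈ B} :=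
      (((hS n hn).const_smul (n : ℝ)⁻¹).comp (hfreeze _)) hB
    have h1 := hstat.measure_shift_iterate_mem hX (i * n) hD
    have h2 := hstat.measure_shift_iterate_mem hX (0 * n) hD
    exact congrArg ENNReal.toReal (h1.trans h2.symm)
  have hdist := happ.eventually_dist_freeze_le e hε3
  have hpball : ∀ᶠ n in atTop,
      meanLaw P X S n (Metric.ball x (ε / 3)) ≤ ENNReal.ofReal (P.real (A n 0)) := by
    filter_upwards [hdist, eventually_ge_atTop 1] with n hn hn1
    rw [meanLaw_apply hX (hS n hn1) Metric.isOpen_ball.measurableSet, ofReal_measureReal]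
    refine measure_mono fun ω hω => ?_
    have h1 : dist ((n : ℝ)⁻¹ • S n fun i => X i ω) x < ε / 3 := hω
    have h2 := hn fun i => X i ω
    have h3 := dist_triangle_left ((n : ℝ)⁻¹ • S n (freeze e (2 * n) fun i => X i ω)) x
      ((n : ℝ)⁻¹ • S n fun i => X i ω)
    have h4 : (n : ℝ)⁻¹ • S n (freeze e (2 * n) fun i => X i ω) ∈ B := by
      rw [hBdef, Metric.mem_closedBall]
      linarith
    simpa [hA] using h4
  have hp : ∀ᶠ n : ℕ in atTop, Real.exp (-(c + η) * n) ≤ P.real (A n 0) := by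
    have hlt : ((-(c + η) : ℝ) : EReal) <
        ExpGrowth.expGrowthInf (fun n => meanLaw P X S n (Metric.ball x (ε / 3))) := by
      refine lt_of_lt_of_le ?_ hlow
      rw [hcI, ← EReal.coe_neg, EReal.coe_lt_coe_iff]
      linarith
    filter_upwards [hpball, ExpGrowth.eventually_exp_le hlt] with n h1 h2
    rw [exp_coe_mul_natCast] at h2
    exact (ENNReal.ofReal_le_ofReal_iff measureReal_nonneg).1 (h2.trans h1)
  have hK : ∀ᶠ n : ℕ in atTop, Real.exp ((c + 3 * η) * n) ≤ k n := by
    filter_upwards [ExpGrowth.eventually_exp_le hbk] with n hn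
    rw [exp_coe_mul_natCast, ← ENNReal.ofReal_natCast,
      ENNReal.ofReal_le_ofReal_iff (Nat.cast_nonneg _)] at hn
    rwa [← hbη]
  have hcov : ∀ n, 1 ≤ n → ∀ L, 1 ≤ L → ∀ i j, i + (L + 2) ≤ j →
      |P.real (A n i) * P.real (A n j) - P.real (A n i ∩ A n j)| ≤ rosenblatt P X L := by
    intro n hn L hL i j hij
    -- Event i uses times up to in + 2n - 1, overlapping the next block; the 2 in L + 2 absorbs this
    -- overlap.
    have hgap : i * n + 2 * n - 1 + L ≤ j * n := by
      have h1 : (i + (L + 2)) * n ≤ j * n := Nat.mul_le_mul_right n hij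
      have h2 : L * 1 ≤ L * n := Nat.mul_le_mul_left L hn
      have h3 : (i + (L + 2)) * n = i * n + L * n + 2 * n := by ring
      omega
    refine (le_alphaCoeff (hAmeas _ n hn i fun l _ hl => ?_) (hAmeas _ n hn j fun l hl _ => ?_)).trans
      (alphaCoeff_le_rosenblatt hL (i * n + 2 * n - 1))
    · exact (comap_measurable (X l)).mono (le_iSup₂ (f := fun k
        (_ : k ∈ Set.Iic (i * n + 2 * n - 1)) => MeasurableSpace.comap (X k) inferInstance) l
        (Set.mem_Iic.2 (by omega))) le_rfl
    · exact (comap_measurable (X l)).mono (le_iSup₂ (f := fun k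
        (_ : k ∈ Set.Ici (i * n + 2 * n - 1 + L)) => MeasurableSpace.comap (X k) inferInstance) l
        (Set.mem_Ici.2 (hgap.trans hl))) le_rfl
  have hmain := ae_eventually_half_lt_count (P := P) (A := A) (p := fun n => P.real (A n 0))
    (K := k) (fun n hn i => hAmeas _ n hn i fun l _ _ => hX l) hstatA
    (fun h hh => hmix.rosenblatt_le hh) hcov hc0 hη0 hp hK
  filter_upwards [hmain] with ω hω
  -- The lost factor 1/2 does not affect the exponential rate.
  refine hlow.trans (ExpGrowth.expGrowthInf_of_eventually_ge (b := ENNReal.ofReal (1 / 2))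
    (by simp) ?_)
  filter_upwards [hω, hpball, hdist, hK] with n h1 h2 h3 h4
  have hk0 : (0 : ℝ) < k n := (Real.exp_pos _).trans_le h4
  rw [empiricalMeasure_apply _ _ Metric.isClosed_closedBall.measurableSet]
  calc _ ≤ ENNReal.ofReal (1 / 2) * ENNReal.ofReal (P.real (A n 0)) := by gcongr
    _ = (k n : ℝ≥0∞)⁻¹ * ENNReal.ofReal (k n * P.real (A n 0) / 2) := by
        rw [← ENNReal.ofReal_natCast (k n), ← ENNReal.ofReal_inv_of_pos hk0,
          ← ENNReal.ofReal_mul (by positivity), ← ENNReal.ofReal_mul (by positivity)]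
        congr 1
        field_simp
    _ ≤ _ := by
        gcongr
        refine (ENNReal.ofReal_le_ofReal h1.le).trans ?_
        -- Events are indexed from 0 and blocks from 1: event i concerns block i + 1.
        have hIcc : Finset.Icc 1 (k n) = Finset.Ico (0 + 1) (k n + 1) := by
          ext j
          simp only [Finset.mem_Icc, Finset.mem_Ico]
          omega
        rw [ENNReal.ofReal_sum_of_nonneg fun i _ => Set.indicator_nonneg (by simp) _, hIcc,
          ← Finset.sum_Ico_add' _ 0 (k n) 1, ← Finset.range_eq_Ico]
        refine Finset.sum_le_sum fun i _ => ?_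
        by_cases hi : ω ∈ A n i
        · have hmem : blockMean X S n (i + 1) ω ∈ Metric.closedBall x ε := by
            have h5 := h3 (shift^[i * n] fun l => X l ω)
            have h6 : dist ((n : ℝ)⁻¹ • S n (freeze e (2 * n) (shift^[i * n] fun l => X l ω))) x ≤
                2 * ε / 3 := hi
            rw [Metric.mem_closedBall, blockMean, Nat.add_sub_cancel]
            linarith [dist_triangle ((n : ℝ)⁻¹ • S n (shift^[i * n] fun l => X l ω))
              ((n : ℝ)⁻¹ • S n (freeze e (2 * n) (shift^[i * n] fun l => X l ω))) x]
          simp [Set.indicator_of_mem hi, Set.indicator_of_mem hmem]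
        · simp [Set.indicator_of_notMem hi]

end Blocks

end LocalFluctuations

/-! ### Assembly of the three statements -/

theorem theorem2p1 {Ω E Y : Type*} [MeasurableSpace Ω] [MeasurableSpace E]
    [NormedAddCommGroup Y] [NormedSpace ℝ Y] [MeasurableSpace Y] [BorelSpace Y]
    (P : Measure Ω) [IsProbabilityMeasure P]
    (X : ℕ → Ω → E) (hX : ∀ i, Measurable (X i)) (hstat : IsStationaryProcess P X)
    (S : ℕ → (ℕ → E) → Y) (hS : ∀ n, 1 ≤ n → Measurable (S n))
    (k : ℕ → ℕ) (hk : ∀ n, 1 ≤ n → 1 ≤ k n) (hkmono : MonotoneOn k (Set.Ici 1))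
    (I : Y → ℝ≥0∞)
    (hA1 : SatisfiesLDP (meanLaw P X S) I)
    (hA2 : IsMixing P X)
    (hA3 : HasLocalApprox S) :
    (∀ x : Y, I x < ∞ →
      ((I x : EReal) < ExpGrowth.expGrowthInf (fun n => (k n : ℝ≥0∞)) →
        ∀ᵐ ω ∂P,
          Tendsto (fun ε : ℝ => ExpGrowth.expGrowthInf
            (fun n => empiricalMeasure X S k ω n (Metric.closedBall x ε)))
            (𝓝[>] 0) (𝓝 (-(I x : EReal))) ∧
          Tendsto (fun ε : ℝ => ExpGrowth.expGrowthSup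
            (fun n => empiricalMeasure X S k ω n (Metric.closedBall x ε)))
            (𝓝[>] 0) (𝓝 (-(I x : EReal)))) ∧
      (ExpGrowth.expGrowthSup (fun n => (k n : ℝ≥0∞)) < (I x : EReal) →
        ∃ ε : ℝ, 0 < ε ∧ ∀ᵐ ω ∂P, ∀ᶠ n in atTop,
          {j : ℕ | 1 ≤ j ∧ j ≤ k n ∧ blockMean X S n j ω ∈ Metric.closedBall x ε} = ∅)) ∧
    (∀ x : Y, I x = ∞ →
      ∀ᵐ ω ∂P,
        Tendsto (fun ε : ℝ => ExpGrowth.expGrowthSup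
          (fun n => empiricalMeasure X S k ω n (Metric.closedBall x ε)))
          (𝓝[>] 0) (𝓝 ⊥)) ∧
    (ExponentiallyTight (meanLaw P X S) →
      ∀ᵐ ω ∂P, ExponentiallyTight (empiricalMeasure X S k ω)) := by
  refine ⟨fun x hx => ⟨fun hkx => ?_, fun hkx =>
    exists_ae_eventually_blockMean_notMem hX hstat hS hA1 hkx⟩, fun x hx => ?_, fun htight => ?_⟩
  · have hlow := ae_all_iff.2 fun m : ℕ => ae_le_expGrowthInf_empiricalMeasure hX hstat hS hA1 hA2
      hA3 hx hkx (show (0 : ℝ) < 1 / (m + 1) by positivity)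
    filter_upwards [ae_eventually_expGrowthSup_empiricalMeasure_lt hX hstat hS hk hA1 x, hlow]
      with ω hup hlow
    have hlow' : ∀ᶠ ε in 𝓝[>] (0 : ℝ), -(I x : EReal) ≤ ExpGrowth.expGrowthInf
        (fun n => empiricalMeasure X S k ω n (Metric.closedBall x ε)) := by
      filter_upwards [self_mem_nhdsWithin] with ε hε
      obtain ⟨m, hm⟩ := exists_nat_one_div_lt (Set.mem_Ioi.1 hε)
      exact (hlow m).trans (ExpGrowth.expGrowthInf_monotone fun n =>
        measure_mono (Metric.closedBall_subset_closedBall hm.le))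
    refine ⟨tendsto_order.2 ⟨fun a ha => ?_, fun b hb => ?_⟩,
      tendsto_order.2 ⟨fun a ha => ?_, fun b hb => hup b hb⟩⟩
    · filter_upwards [hlow'] with ε hε using ha.trans_le hε
    · filter_upwards [hup b hb] with ε hε using
        ExpGrowth.expGrowthInf_le_expGrowthSup.trans_lt hε
    · filter_upwards [hlow'] with ε hε using
        ha.trans_le (hε.trans ExpGrowth.expGrowthInf_le_expGrowthSup)
  · filter_upwards [ae_eventually_expGrowthSup_empiricalMeasure_lt hX hstat hS hk hA1 x] with ω hup
    refine tendsto_order.2 ⟨fun a ha => absurd ha not_lt_bot, fun b hb => hup b ?_⟩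
    rwa [hx, EReal.coe_ennreal_top, EReal.neg_top]
  -- Integer levels suffice, so countably many compact sets, Borel because closed, share one null
  -- set.
  · choose K hK hKgrowth using htight
    have hall := ae_all_iff.2 fun m : ℕ => ae_expGrowthSup_empiricalMeasure_le hX hstat hS hk
      (hK m).isClosed.measurableSet.compl
    filter_upwards [hall] with ω hω a
    obtain ⟨m, hm⟩ := exists_nat_ge a
    refine ⟨K m, hK m, (hω m).trans ((hKgrowth m).trans ?_)⟩
    exact EReal.coe_le_coe_iff.2 (neg_le_neg hm)
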